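/- Let $G=(V,E)$ be a finite connected simple undirected graph; write $N(i)$ for the set of neighbours of $i$. Each vertex (agent) $i\in V$ has an urn which at time $0$ contains exactly one ball, black or white; the joint law of the initial colours is arbitrary. At each stage $t+1$ ($t\ge 0$) every agent $i$ draws one ball uniformly at random, with replacement, from her urn; conditionally on the initial colours and all draws of stages $1,\dots,t$, the draws of different agents at stage $t+1$ are pairwise independent. Let $X_i^{t+1}\in\{0,1\}$ be the indicator that agent $i$ draws black. Then every urn $i$ receives, for each neighbour $j\in N(i)$, one additional ball of the colour drawn by $j$, so that the numbers $B_i^t$ and $W_i^t$ of black and white balls satisfy $$B_i^{t+1}=B_i^t+\sum_{j\in N(i)}X_j^{t+1},\qquad W_i^{t+1}=W_i^t+\sum_{j\in N(i)}(1-X_j^{t+1}).$$ Let $Z_i^t=B_i^t/(B_i^t+W_i^t)$. Then almost surely the limits $\lim_{t\to\infty}Z_i^t$, $i\in V$, exist and are all equal: for any $i,j\in V$, $\lim_{t\to\infty}Z_i^t=\lim_{t\to\infty}Z_j^t$ almost surely. -/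

import Mathlib

open MeasureTheory ProbabilityTheory Filter Topology

namespace UrnNetwork

/-! Colours are coded by `Bool`: `true` is a black ball and `false` is a white ball.
`signal i` is the colour of the single ball that is initially in the urn of agent `i`, and
`draw t i` is the colour drawn by agent `i` at stage `t`, for `t ≥ 1` (`draw 0` is never used). -/

/-- Number of black balls in the urn of agent `i` after stage `t`: it starts with the ball given by
the signal, and every neighbour that draws black adds one black ball. -/
def blackCount {V : Type*} [Fintype V] (G : SimpleGraph V) [DecidableRel G.Adj]
    (signal : V → Bool) (draw : ℕ → V → Bool) : ℕ → V → ℕ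
  | 0, i => if signal i = true then 1 else 0
  | t + 1, i => blackCount G signal draw t i
      + ((G.neighborFinset i).filter fun j => draw (t + 1) j = true).card

/-- Number of white balls in the urn of agent `i` after stage `t`. -/
def whiteCount {V : Type*} [Fintype V] (G : SimpleGraph V) [DecidableRel G.Adj]
    (signal : V → Bool) (draw : ℕ → V → Bool) : ℕ → V → ℕ
  | 0, i => if signal i = false then 1 else 0
  | t + 1, i => whiteCount G signal draw t i
      + ((G.neighborFinset i).filter fun j => draw (t + 1) j = false).card

/-- Proportion of black balls in the urn of agent `i` after stage `t`. -/
noncomputable def blackProportion {V : Type*} [Fintype V] (G : SimpleGraph V) [DecidableRel G.Adj]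
    (signal : V → Bool) (draw : ℕ → V → Bool) (t : ℕ) (i : V) : ℝ :=
  (blackCount G signal draw t i : ℝ) /
    ((blackCount G signal draw t i : ℝ) + (whiteCount G signal draw t i : ℝ))

/-- The sigma-algebra generated by the initial signals and the draws of the stages `1, …, t`. -/
abbrev history {V Ω : Type*} (signal : V → Ω → Bool) (draw : ℕ → V → Ω → Bool) (t : ℕ) :
    MeasurableSpace Ω :=
  (⨆ i, MeasurableSpace.comap (signal i) ⊤) ⊔
    ⨆ k ∈ Finset.Icc 1 t, ⨆ i, MeasurableSpace.comap (draw k i) ⊤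

/-- The random proportion of black balls in the urn of agent `i` after stage `t`. -/
noncomputable def Z {V Ω : Type*} [Fintype V] (G : SimpleGraph V) [DecidableRel G.Adj]
    (signal : V → Ω → Bool) (draw : ℕ → V → Ω → Bool) (t : ℕ) (i : V) (ω : Ω) : ℝ :=
  blackProportion G (fun j => signal j ω) (fun k j => draw k j ω) t i

/-- The random signals and draws follow the urn dynamics on the graph `G`: at each stage every
agent draws one ball uniformly from her current urn, and, given the past, the draws of the agents
at that stage are pairwise independent. The joint law of the initial signals is arbitrary. -/
structure IsUrnProcess {V Ω : Type*} [Fintype V] [MeasurableSpace Ω]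
    (G : SimpleGraph V) [DecidableRel G.Adj] (μ : Measure Ω)
    (signal : V → Ω → Bool) (draw : ℕ → V → Ω → Bool) : Prop where
  measurable_signal : ∀ i, Measurable (signal i)
  measurable_draw : ∀ t i, Measurable (draw (t + 1) i)
  /-- given the past, agent `i` draws black with the current proportion of black in her urn -/
  condProb_draw : ∀ t i,
    μ⟦{ω | draw (t + 1) i ω = true} | history signal draw t⟧ =ᵐ[μ] fun ω => Z G signal draw t i ω
  /-- given the past, the draws of two different agents are independent -/
  condIndep_draw : ∀ t i j, i ≠ j → ∀ a b : Bool,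
    μ⟦{ω | draw (t + 1) i ω = a} ∩ {ω | draw (t + 1) j ω = b} | history signal draw t⟧ =ᵐ[μ]
      fun ω => (μ⟦{ω' | draw (t + 1) i ω' = a} | history signal draw t⟧) ω *
        (μ⟦{ω' | draw (t + 1) j ω' = b} | history signal draw t⟧) ω

end UrnNetwork

/-!
The idea is a Lyapunov argument for the degree-weighted first and second moments of the proportions.
Write `dᵢ` for the degrees, `W = ∑ dᵢ`, and `𝓔(z)` for the Dirichlet energy, the sum of
`(zᵢ - zⱼ)²` over oriented edges. An urn with `dᵢ` neighbours gains `dᵢ` balls per stage, so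
`dᵢ Zᵢ` moves by `(∑_{j ∼ i} Xⱼ - dᵢ Zᵢ) / (t + 1)` up to `O(1 / t²)`
(`degree_mul_increment_le`). By symmetry of adjacency, up to martingale differences and errors of
order `1 / t²`,

* `M = ∑ dᵢ Zᵢ` does not increase (`sum_degree_mul_blackProportion_succ_le`),
* `E = ∑ dᵢ Zᵢ²` decreases by `𝓔(Z) / (t + 1)`
  (`sum_degree_mul_blackProportion_sq_succ_le`).

A nonnegative process that increases by at most a martingale difference plus a summable error
converges almost surely (`ae_exists_tendsto_of_le_add_martingaleDiff`). Applied to `M`, to `E`, and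
to `E` plus the dissipated energy `∑_{s < t} 𝓔(Z^s) / (s + 1)`, this gives the convergence of `M`
and `E` and the summability of `𝓔(Z^t) / (t + 1)`.

The variance `W E - M²` therefore converges; it is at most a constant times `𝓔(Z)` on a
connected graph (`exists_variance_le_mul_energy`), and `𝓔(Z)` is not bounded away from `0` because
the harmonic series diverges. Its limit is thus `0`, all differences `Zᵢ - Zⱼ` vanish in the limit,
and every `Zᵢ` tends to `lim M / W` (`exists_tendsto_of_summable_energy`).
-/

namespace UrnNetwork

/-! ### Almost supermartingales -/

/-- A nonnegative adapted process whose increments exceed a martingale difference by at most a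
summable deterministic error converges almost surely. -/
theorem ae_exists_tendsto_of_le_add_martingaleDiff {Ω : Type*} {m0 : MeasurableSpace Ω}
    {μ : Measure Ω} [IsProbabilityMeasure μ] (ℱ : Filtration ℕ m0) {U D : ℕ → Ω → ℝ} {c : ℕ → ℝ}
    (hU : StronglyAdapted ℱ U) (hUi : ∀ t, Integrable (U t) μ) (hU0 : ∀ t ω, 0 ≤ U t ω)
    (hDi : ∀ t, Integrable (D t) μ) (hD : ∀ t, μ[D t | ℱ t] =ᵐ[μ] 0)
    (hc0 : ∀ t, 0 ≤ c t) (hc : Summable c)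
    (hle : ∀ t ω, U (t + 1) ω ≤ U t ω + D t ω + c t) :
    ∀ᵐ ω ∂μ, ∃ l : ℝ, Tendsto (fun t => U t ω) atTop (𝓝 l) := by
  have hDint : ∀ t, ∫ ω, D t ω ∂μ = 0 := fun t => by
    rw [← integral_condExp (ℱ.le t), integral_congr_ae (hD t)]; simp
  have hint : ∀ n, ∫ ω, U n ω ∂μ ≤ ∫ ω, U 0 ω ∂μ + ∑ s ∈ Finset.range n, c s := by
    intro n
    induction n with
    | zero => simp
    | succ n ih =>
      have h1 : ∫ ω, U (n + 1) ω ∂μ ≤ ∫ ω, (U n ω + D n ω + c n) ∂μ :=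
        integral_mono (hUi _) (((hUi n).add (hDi n)).add (integrable_const _)) (hle n)
      have h2 : Integrable (fun ω => U n ω + D n ω) μ := (hUi n).add (hDi n)
      rw [integral_add h2 (integrable_const _), integral_add (hUi n) (hDi n), hDint] at h1
      simp only [integral_const, probReal_univ, one_smul] at h1
      rw [Finset.sum_range_succ]
      linarith
  let S : ℕ → Ω → ℝ := fun n ω => (∑ s ∈ Finset.range n, c s) - U n ω
  have hSi : ∀ n, Integrable (S n) μ := fun n => (integrable_const _).sub (hUi n)
  have hSm : ∀ n, StronglyMeasurable[ℱ n] (S n) := fun n => stronglyMeasurable_const.sub (hU n)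
  have hS : Submartingale S ℱ μ := by
    refine submartingale_nat hSm hSi fun t => ?_
    have h1 : S t + - D t ≤ᵐ[μ] S (t + 1) := ae_of_all _ fun ω => by
      simp only [Pi.add_apply, Pi.neg_apply, S, Finset.sum_range_succ]
      linarith [hle t ω]
    have h2 := condExp_mono (m := ℱ t) ((hSi t).add (hDi t).neg) (hSi (t + 1)) h1
    have h3 : μ[S t + - D t | ℱ t] =ᵐ[μ] S t := by
      refine (condExp_add (hSi t) (hDi t).neg _).trans ?_
      rw [condExp_of_stronglyMeasurable (ℱ.le t) (hSm t) (hSi t)]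
      filter_upwards [condExp_neg (μ := μ) (D t) (ℱ t), hD t] with ω hω hω'
      rw [Pi.add_apply, hω, Pi.neg_apply, hω']
      simp
    exact h3.symm.le.trans h2
  have hbdd : ∀ n, eLpNorm (S n) 1 μ ≤
      ((∑' s, c s + (∫ ω, U 0 ω ∂μ + ∑' s, c s)).toNNReal : NNReal) := by
    intro n
    have hsum : ∑ s ∈ Finset.range n, c s ≤ ∑' s, c s := hc.sum_le_tsum _ fun s _ => hc0 s
    have hsum0 : 0 ≤ ∑ s ∈ Finset.range n, c s := Finset.sum_nonneg fun s _ => hc0 s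
    rw [eLpNorm_one_eq_lintegral_enorm, ← ofReal_integral_norm_eq_lintegral_enorm (hSi n)]
    refine ENNReal.ofReal_le_ofReal ?_
    calc ∫ ω, ‖S n ω‖ ∂μ ≤ ∫ ω, (∑' s, c s + U n ω) ∂μ := by
          refine integral_mono (hSi n).norm ((integrable_const _).add (hUi n)) fun ω => ?_
          have := hU0 n ω
          simp only [S, Real.norm_eq_abs]
          rw [abs_le]
          constructor <;> linarith
      _ = ∑' s, c s + ∫ ω, U n ω ∂μ := by
          rw [integral_add (integrable_const _) (hUi n)]; simp
      _ ≤ _ := by linarith [hint n]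
  filter_upwards [hS.exists_ae_tendsto_of_bdd hbdd] with ω ⟨l, hl⟩
  refine ⟨∑' s, c s - l, ?_⟩
  simpa [S] using hc.hasSum.tendsto_sum_nat.sub hl

/-! ### Dirichlet energy on a connected graph -/

section Energy

variable {V : Type*} [Fintype V] (G : SimpleGraph V) [DecidableRel G.Adj]

/-- The Dirichlet energy of `z : V → ℝ`: each edge contributes the square of the difference
of its end values, once for each of its two orientations. -/
noncomputable def energy (z : V → ℝ) : ℝ := ∑ i, ∑ j ∈ G.neighborFinset i, (z i - z j) ^ 2

theorem energy_nonneg (z : V → ℝ) : 0 ≤ energy G z :=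
  Finset.sum_nonneg fun _ _ => Finset.sum_nonneg fun _ _ => sq_nonneg _

theorem sum_neighborFinset_comm (f : V → V → ℝ) :
    ∑ i, ∑ j ∈ G.neighborFinset i, f i j = ∑ i, ∑ j ∈ G.neighborFinset i, f j i :=
  Finset.sum_comm' fun i j => by simp [G.adj_comm]

theorem sum_mul_laplacian (z : V → ℝ) :
    ∑ i, 2 * z i * ∑ j ∈ G.neighborFinset i, (z j - z i) = - energy G z := by
  have h := sum_neighborFinset_comm G fun i j => 2 * z i * (z j - z i)
  have h2 : ∑ i, 2 * z i * ∑ j ∈ G.neighborFinset i, (z j - z i)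
      = ∑ i, ∑ j ∈ G.neighborFinset i, 2 * z i * (z j - z i) := by
    simp only [Finset.mul_sum]
  have h3 : (∑ i, ∑ j ∈ G.neighborFinset i, 2 * z i * (z j - z i))
      + ∑ i, ∑ j ∈ G.neighborFinset i, 2 * z j * (z i - z j) = - (2 * energy G z) := by
    simp only [energy, Finset.mul_sum, ← Finset.sum_neg_distrib, ← Finset.sum_add_distrib]
    refine Finset.sum_congr rfl fun i _ => Finset.sum_congr rfl fun j _ => by ring
  linarith

theorem abs_sub_le_dist_mul_sqrt_energy (hG : G.Connected) (z : V → ℝ) (i j : V) :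
    |z i - z j| ≤ G.dist i j * √(energy G z) := by
  obtain ⟨p, hp⟩ := hG.exists_walk_length_eq_dist i j
  rw [← hp]
  clear hp
  induction p with
  | nil => simp
  | @cons u v w h p ih =>
    have h1 : |z u - z v| ≤ √(energy G z) := by
      refine Real.abs_le_sqrt ?_
      calc (z u - z v) ^ 2 ≤ ∑ j ∈ G.neighborFinset u, (z u - z j) ^ 2 :=
            Finset.single_le_sum (f := fun j => (z u - z j) ^ 2) (fun _ _ => sq_nonneg _) (by simpa)
        _ ≤ energy G z :=
            Finset.single_le_sum (f := fun i => ∑ j ∈ G.neighborFinset i, (z i - z j) ^ 2)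
              (fun _ _ => Finset.sum_nonneg fun _ _ => sq_nonneg _) (Finset.mem_univ u)
    calc |z u - z w| ≤ |z u - z v| + |z v - z w| := abs_sub_le _ _ _
      _ ≤ _ := by rw [SimpleGraph.Walk.length_cons]; push_cast; linarith

/-- The degree-weighted variance as a sum over pairs of vertices. -/
theorem sum_sum_degree_mul_sub_sq (z : V → ℝ) :
    ∑ i, ∑ j, (G.degree i : ℝ) * G.degree j * (z i - z j) ^ 2 =
      2 * ((∑ i, (G.degree i : ℝ)) * (∑ i, G.degree i * z i ^ 2)
        - (∑ i, G.degree i * z i) ^ 2) := by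
  have h1 : (∑ i, (G.degree i : ℝ)) * (∑ i, G.degree i * z i ^ 2)
      = ∑ i, ∑ j, (G.degree i : ℝ) * (G.degree j * z j ^ 2) := Finset.sum_mul_sum _ _ _ _
  have h2 : (∑ i, G.degree i * z i ^ 2) * (∑ i, (G.degree i : ℝ))
      = ∑ i, ∑ j, (G.degree i * z i ^ 2) * (G.degree j : ℝ) := Finset.sum_mul_sum _ _ _ _
  have h3 : (∑ i, G.degree i * z i) * (∑ i, G.degree i * z i)
      = ∑ i, ∑ j, (G.degree i * z i) * (G.degree j * z j) := Finset.sum_mul_sum _ _ _ _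
  have h4 : ∑ i, ∑ j, (G.degree i : ℝ) * G.degree j * (z i - z j) ^ 2 =
      (∑ i, ∑ j, (G.degree i : ℝ) * (G.degree j * z j ^ 2))
      + (∑ i, ∑ j, (G.degree i * z i ^ 2) * (G.degree j : ℝ))
      - 2 * ∑ i, ∑ j, (G.degree i * z i) * (G.degree j * z j) := by
    simp only [Finset.mul_sum, ← Finset.sum_add_distrib, ← Finset.sum_sub_distrib]
    refine Finset.sum_congr rfl fun i _ => Finset.sum_congr rfl fun j _ => by ring
  rw [h4, ← h1, ← h2, ← h3]
  ring

/-- A Poincaré inequality: the degree-weighted variance, written as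
`W ∑ dᵢ zᵢ² - (∑ dᵢ zᵢ)²` with `W = ∑ dᵢ`, is controlled by the Dirichlet energy. -/
theorem exists_variance_le_mul_energy (hG : G.Connected) : ∃ K : ℝ, ∀ z : V → ℝ,
    (∑ i, (G.degree i : ℝ)) * (∑ i, G.degree i * z i ^ 2) - (∑ i, G.degree i * z i) ^ 2
      ≤ K * energy G z := by
  refine ⟨∑ i, ∑ j, (G.degree i : ℝ) * G.degree j * (G.dist i j : ℝ) ^ 2, fun z => ?_⟩
  have h0 := energy_nonneg G z
  have h1 : ∑ i, ∑ j, (G.degree i : ℝ) * G.degree j * (z i - z j) ^ 2 ≤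
      (∑ i, ∑ j, (G.degree i : ℝ) * G.degree j * (G.dist i j : ℝ) ^ 2) * energy G z := by
    simp only [Finset.sum_mul]
    refine Finset.sum_le_sum fun i _ => Finset.sum_le_sum fun j _ => ?_
    rw [mul_assoc _ _ (energy G z)]
    refine mul_le_mul_of_nonneg_left ?_ (by positivity)
    have := pow_le_pow_left₀ (abs_nonneg _) (abs_sub_le_dist_mul_sqrt_energy G hG z i j) 2
    rwa [sq_abs, mul_pow, Real.sq_sqrt h0] at this
  rw [sum_sum_degree_mul_sub_sq G z] at h1
  have h2 := sum_sum_degree_mul_sub_sq G z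
  have h3 : 0 ≤ ∑ i, ∑ j, (G.degree i : ℝ) * G.degree j * (z i - z j) ^ 2 := by positivity
  linarith

end Energy

/-! ### The urn recursion -/

/-- The indicator, as a real number, that the drawn ball is black. -/
def black (b : Bool) : ℝ := if b = true then 1 else 0

theorem black_mem_Icc (b : Bool) : black b ∈ Set.Icc (0 : ℝ) 1 := by
  cases b <;> simp [black]

section Recursion

variable {V : Type*} [Fintype V] (G : SimpleGraph V) [DecidableRel G.Adj]
  (signal : V → Bool) (draw : ℕ → V → Bool)

theorem blackCount_add_whiteCount (t : ℕ) (i : V) :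
    blackCount G signal draw t i + whiteCount G signal draw t i = 1 + G.degree i * t := by
  induction t with
  | zero => cases h : signal i <;> simp [blackCount, whiteCount, h]
  | succ t ih =>
    have h := Finset.card_filter_add_card_filter_not (s := G.neighborFinset i)
      (fun j => draw (t + 1) j = true)
    simp only [Bool.not_eq_true, SimpleGraph.card_neighborFinset_eq_degree] at h
    simp only [blackCount, whiteCount, mul_add, mul_one]
    omega

theorem blackProportion_eq_div (t : ℕ) (i : V) :
    blackProportion G signal draw t i
      = blackCount G signal draw t i / (1 + G.degree i * t : ℝ) := by
  have h := congrArg (Nat.cast (R := ℝ)) (blackCount_add_whiteCount G signal draw t i)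
  push_cast at h
  rw [blackProportion, h]

theorem blackProportion_mem_Icc (t : ℕ) (i : V) :
    blackProportion G signal draw t i ∈ Set.Icc (0 : ℝ) 1 :=
  ⟨by unfold blackProportion; positivity,
    div_le_one_of_le₀ (by simp) (by positivity)⟩

theorem blackProportion_succ (t : ℕ) (i : V) :
    blackProportion G signal draw (t + 1) i = blackProportion G signal draw t i
      + (∑ j ∈ G.neighborFinset i, (black (draw (t + 1) j) - blackProportion G signal draw t i))
        / (1 + G.degree i * (t + 1)) := by
  have h : (blackCount G signal draw (t + 1) i : ℝ) = blackCount G signal draw t i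
      + ∑ j ∈ G.neighborFinset i, black (draw (t + 1) j) := by
    simp [blackCount, black, Finset.sum_boole]
  rw [Finset.sum_sub_distrib, Finset.sum_const, SimpleGraph.card_neighborFinset_eq_degree,
    nsmul_eq_mul, blackProportion_eq_div, blackProportion_eq_div, h]
  push_cast
  have h1 : (1 + G.degree i * (t + 1) : ℝ) ≠ 0 := by positivity
  have h2 : (1 + G.degree i * t : ℝ) ≠ 0 := by positivity
  field_simp
  ring

/-- The step size of an urn with `d` neighbours at stage `τ`, multiplied by `d`, is `1 / τ` up to
an error of order `1 / τ ^ 2`. -/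
theorem degree_mul_increment_le {d τ s : ℝ} (hd : 0 ≤ d) (hτ : 0 < τ) (hs : |s| ≤ d) :
    |d * (s / (1 + d * τ)) - s / τ| ≤ 1 / τ ^ 2 := by
  have h1 : 0 < 1 + d * τ := by positivity
  have h2 : d * (s / (1 + d * τ)) - s / τ = - s / (τ * (1 + d * τ)) := by
    field_simp
    ring
  rw [h2, abs_div, abs_neg, abs_of_pos (by positivity : 0 < τ * (1 + d * τ)),
    div_le_div_iff₀ (by positivity) (by positivity)]
  have h3 : |s| * τ ^ 2 ≤ d * τ ^ 2 := by gcongr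
  nlinarith

theorem abs_sum_black_sub_le (t : ℕ) (i : V) :
    |∑ j ∈ G.neighborFinset i, (black (draw (t + 1) j) - blackProportion G signal draw t i)|
      ≤ G.degree i := by
  refine (Finset.abs_sum_le_sum_abs _ _).trans ?_
  rw [← SimpleGraph.card_neighborFinset_eq_degree, ← mul_one (Finset.card _ : ℝ), ← nsmul_eq_mul]
  refine Finset.sum_le_card_nsmul _ _ _ fun j _ => ?_
  have h1 := black_mem_Icc (draw (t + 1) j)
  have h2 := blackProportion_mem_Icc G signal draw t i
  exact abs_le.2 ⟨by linarith [h1.1, h2.2], by linarith [h1.2, h2.1]⟩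

theorem degree_mul_blackProportion_succ_le (t : ℕ) (i : V) :
    G.degree i * blackProportion G signal draw (t + 1) i ≤
      G.degree i * blackProportion G signal draw t i
      + (∑ j ∈ G.neighborFinset i, (black (draw (t + 1) j) - blackProportion G signal draw t i))
        / (t + 1)
      + 1 / ((t : ℝ) + 1) ^ 2 := by
  have h := (abs_le.1 (degree_mul_increment_le (Nat.cast_nonneg _) (by positivity : 0 < (t : ℝ) + 1)
    (abs_sum_black_sub_le G signal draw t i))).2
  rw [blackProportion_succ, mul_add]
  linarith

theorem degree_mul_blackProportion_sq_succ_le (t : ℕ) (i : V) :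
    G.degree i * blackProportion G signal draw (t + 1) i ^ 2 ≤
      G.degree i * blackProportion G signal draw t i ^ 2
      + 2 * blackProportion G signal draw t i
        * (∑ j ∈ G.neighborFinset i, (black (draw (t + 1) j) - blackProportion G signal draw t i))
        / (t + 1)
      + (2 + G.degree i) / ((t : ℝ) + 1) ^ 2 := by
  have hs := abs_sum_black_sub_le G signal draw t i
  have hz := blackProportion_mem_Icc G signal draw t i
  have hτ : 0 < (t : ℝ) + 1 := by positivity
  have hd : (0 : ℝ) ≤ G.degree i := by positivity
  have h := (abs_le.1 (degree_mul_increment_le hd hτ hs)).2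
  rw [blackProportion_succ]
  generalize blackProportion G signal draw t i = z at *
  generalize ∑ j ∈ G.neighborFinset i, (black (draw (t + 1) j) - z) = s at *
  generalize (G.degree i : ℝ) = d at *
  generalize (t : ℝ) + 1 = τ at *
  have hδ : |s / (1 + d * τ)| ≤ 1 / τ := by
    rw [abs_div, abs_of_pos (by positivity : 0 < 1 + d * τ), div_le_div_iff₀ (by positivity) hτ]
    nlinarith
  have hδ2 : (s / (1 + d * τ)) ^ 2 ≤ 1 / τ ^ 2 := by
    have := pow_le_pow_left₀ (abs_nonneg _) hδ 2
    rwa [sq_abs, div_pow 1, one_pow] at this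
  generalize s / (1 + d * τ) = δ at *
  have e1 : 2 * z * (d * δ - s / τ) ≤ 2 / τ ^ 2 := by
    have h3 : 0 < 1 / τ ^ 2 := by positivity
    have h4 : 2 * z * (d * δ - s / τ) ≤ 2 * z * (1 / τ ^ 2) :=
      mul_le_mul_of_nonneg_left h (by linarith [hz.1])
    have h5 : 2 * z * (1 / τ ^ 2) ≤ 2 * (1 / τ ^ 2) :=
      mul_le_mul_of_nonneg_right (by linarith [hz.2]) h3.le
    calc _ ≤ 2 * (1 / τ ^ 2) := h4.trans h5
      _ = _ := by ring
  have e2 : d * δ ^ 2 ≤ d / τ ^ 2 := by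
    calc _ ≤ d * (1 / τ ^ 2) := by gcongr
      _ = _ := by ring
  calc d * (z + δ) ^ 2 = d * z ^ 2 + 2 * z * s / τ + 2 * z * (d * δ - s / τ) + d * δ ^ 2 := by
        ring
    _ ≤ d * z ^ 2 + 2 * z * s / τ + 2 / τ ^ 2 + d / τ ^ 2 := by gcongr
    _ = _ := by ring

/-- The degree-weighted sum of the proportions changes, up to a summable error, only by the
centred draws. -/
theorem sum_degree_mul_blackProportion_succ_le (t : ℕ) :
    ∑ i, G.degree i * blackProportion G signal draw (t + 1) i ≤
      ∑ i, G.degree i * blackProportion G signal draw t i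
      + (∑ i, 1 * ∑ j ∈ G.neighborFinset i,
          (black (draw (t + 1) j) - blackProportion G signal draw t j)) / (t + 1)
      + (∑ _i : V, 1) / ((t : ℝ) + 1) ^ 2 := by
  have h0 : ∑ i, 1 * ∑ j ∈ G.neighborFinset i,
      (black (draw (t + 1) j) - blackProportion G signal draw t j) = ∑ i,
        ∑ j ∈ G.neighborFinset i, (black (draw (t + 1) j) - blackProportion G signal draw t i) := by
    have := sum_neighborFinset_comm G fun i _ => blackProportion G signal draw t i
    simp only [one_mul, Finset.sum_sub_distrib]
    linarith
  rw [h0, Finset.sum_div, Finset.sum_div, ← Finset.sum_add_distrib, ← Finset.sum_add_distrib]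
  exact Finset.sum_le_sum fun i _ => degree_mul_blackProportion_succ_le G signal draw t i

/-- The degree-weighted sum of squares dissipates the Dirichlet energy at rate `1 / (t + 1)`, up to
centred draws and a summable error. -/
theorem sum_degree_mul_blackProportion_sq_succ_le (t : ℕ) :
    ∑ i, G.degree i * blackProportion G signal draw (t + 1) i ^ 2
        + energy G (blackProportion G signal draw t) / (t + 1) ≤
      ∑ i, G.degree i * blackProportion G signal draw t i ^ 2
      + (∑ i, 2 * blackProportion G signal draw t i * ∑ j ∈ G.neighborFinset i,
          (black (draw (t + 1) j) - blackProportion G signal draw t j)) / (t + 1)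
      + (∑ i, (2 + G.degree i : ℝ)) / ((t : ℝ) + 1) ^ 2 := by
  have h0 : ∑ i, 2 * blackProportion G signal draw t i * ∑ j ∈ G.neighborFinset i,
        (black (draw (t + 1) j) - blackProportion G signal draw t i)
      = ∑ i, 2 * blackProportion G signal draw t i * ∑ j ∈ G.neighborFinset i,
        (black (draw (t + 1) j) - blackProportion G signal draw t j)
        - energy G (blackProportion G signal draw t) := by
    rw [sub_eq_add_neg, ← sum_mul_laplacian, ← Finset.sum_add_distrib]
    refine Finset.sum_congr rfl fun i _ => ?_
    rw [← mul_add, ← Finset.sum_add_distrib]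
    congr 1
    exact Finset.sum_congr rfl fun j _ => by ring
  have h1 := Finset.sum_le_sum fun i (_ : i ∈ Finset.univ) =>
    degree_mul_blackProportion_sq_succ_le G signal draw t i
  rw [Finset.sum_add_distrib, Finset.sum_add_distrib, ← Finset.sum_div, ← Finset.sum_div, h0,
    sub_div] at h1
  linarith

/-! ### Consensus along a single trajectory -/

/-- If `M = ∑ dᵢ Zᵢ` and `E = ∑ dᵢ Zᵢ²` converge and the energies are summable against
`1 / (t + 1)`, all coordinates converge to the same limit. -/
theorem exists_tendsto_of_summable_energy (hG : G.Connected) [Nontrivial V] {z : ℕ → V → ℝ}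
    {m e : ℝ} (hm : Tendsto (fun t => ∑ i, G.degree i * z t i) atTop (𝓝 m))
    (he : Tendsto (fun t => ∑ i, G.degree i * z t i ^ 2) atTop (𝓝 e))
    (hs : Summable fun t : ℕ => energy G (z t) / (t + 1)) :
    ∃ l : ℝ, ∀ i, Tendsto (fun t => z t i) atTop (𝓝 l) := by
  have hdeg : ∀ i, (0 : ℝ) < G.degree i := fun i => by
    exact_mod_cast hG.preconnected.degree_pos_of_nontrivial i
  obtain ⟨K, hK⟩ := exists_variance_le_mul_energy G hG
  set W : ℝ := ∑ i, (G.degree i : ℝ) with hW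
  have hlim : Tendsto (fun t => W * (∑ i, G.degree i * z t i ^ 2)
      - (∑ i, G.degree i * z t i) ^ 2) atTop (𝓝 (W * e - m ^ 2)) :=
    (he.const_mul W).sub (hm.pow 2)
  have hpos : ∀ t, 0 ≤ W * (∑ i, G.degree i * z t i ^ 2) - (∑ i, G.degree i * z t i) ^ 2 := by
    intro t
    have h1 := sum_sum_degree_mul_sub_sq G (z t)
    have h2 : 0 ≤ ∑ i, ∑ j, (G.degree i : ℝ) * G.degree j * (z t i - z t j) ^ 2 := by positivity
    linarith
  have hzero : W * e - m ^ 2 = 0 := by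
    refine le_antisymm ?_ (ge_of_tendsto' hlim hpos)
    by_contra! hlt
    -- the energy would be bounded below, contradicting divergence of the harmonic series
    have hev : ∀ᶠ t : ℕ in atTop, (W * e - m ^ 2) / 2 ≤ K * energy G (z t) := by
      filter_upwards [hlim.eventually (lt_mem_nhds (half_lt_self hlt))] with t ht
      exact ht.le.trans (hK _)
    obtain ⟨N, hN⟩ := eventually_atTop.1 hev
    have hs2 : Summable fun t : ℕ => (W * e - m ^ 2) / 2 * (1 / ((t : ℝ) + 1)) := by
      have h4 := (summable_nat_add_iff N).2 (hs.mul_left K)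
      refine (summable_nat_add_iff N).1 (Summable.of_nonneg_of_le (fun t => ?_) (fun t => ?_) h4)
      · positivity
      · rw [mul_one_div, ← mul_div_assoc]
        gcongr
        exact hN _ (by omega)
    rw [summable_mul_left_iff (by linarith)] at hs2
    refine Real.not_summable_one_div_natCast ((summable_nat_add_iff 1).1 ?_)
    simpa using hs2
  rw [hzero] at hlim
  have hdiff : ∀ i j, Tendsto (fun t => z t i - z t j) atTop (𝓝 0) := by
    intro i j
    have hc : 0 < (G.degree i : ℝ) * G.degree j := mul_pos (hdeg i) (hdeg j)
    have hsq : Tendsto (fun t => (z t i - z t j) ^ 2) atTop (𝓝 0) := by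
      refine squeeze_zero (fun t => sq_nonneg _) (fun t => ?_)
        (by simpa using hlim.const_mul (2 / ((G.degree i : ℝ) * G.degree j)))
      rw [div_mul_eq_mul_div, le_div_iff₀ hc, ← sum_sum_degree_mul_sub_sq, mul_comm]
      calc (G.degree i : ℝ) * G.degree j * (z t i - z t j) ^ 2
          ≤ ∑ j, (G.degree i : ℝ) * G.degree j * (z t i - z t j) ^ 2 :=
            Finset.single_le_sum
              (f := fun j => (G.degree i : ℝ) * G.degree j * (z t i - z t j) ^ 2)
              (fun _ _ => by positivity) (Finset.mem_univ j)
        _ ≤ _ :=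
            Finset.single_le_sum
              (f := fun i => ∑ j, (G.degree i : ℝ) * G.degree j * (z t i - z t j) ^ 2)
              (fun _ _ => by positivity) (Finset.mem_univ i)
    have h := hsq.sqrt
    simp only [Real.sqrt_sq_eq_abs, Real.sqrt_zero] at h
    exact (tendsto_zero_iff_abs_tendsto_zero _).2 h
  have hWpos : 0 < W := Finset.sum_pos (fun i _ => hdeg i) Finset.univ_nonempty
  refine ⟨m / W, fun i => ?_⟩
  have h1 : Tendsto (fun t => ∑ j, G.degree j * (z t j - z t i)) atTop (𝓝 0) := by
    simpa using tendsto_finsetSum Finset.univ fun j _ => (hdiff j i).const_mul (G.degree j : ℝ)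
  have h2 := (hm.sub h1).div_const W
  rw [sub_zero] at h2
  refine h2.congr fun t => ?_
  rw [← Finset.sum_sub_distrib, div_eq_iff hWpos.ne', hW, Finset.mul_sum]
  exact Finset.sum_congr rfl fun j _ => by ring

end Recursion

/-! ### The centred draws and the filtration -/

section History

variable {V Ω : Type*} {signal : V → Ω → Bool} {draw : ℕ → V → Ω → Bool}

theorem measurable_signal_history (t : ℕ) (i : V) : Measurable[history signal draw t] (signal i) :=
  Measurable.of_comap_le <|
    (le_iSup (fun i => MeasurableSpace.comap (signal i) ⊤) i).trans le_sup_left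

theorem measurable_draw_history {k t : ℕ} (hk : k ∈ Finset.Icc 1 t) (i : V) :
    Measurable[history signal draw t] (draw k i) :=
  Measurable.of_comap_le <|
    (le_iSup (fun i => MeasurableSpace.comap (draw k i) ⊤) i).trans <|
      (le_iSup₂ (f := fun k (_ : k ∈ Finset.Icc 1 t) =>
        ⨆ i, MeasurableSpace.comap (draw k i) ⊤) k hk).trans le_sup_right

theorem history_mono : Monotone (history signal draw) := fun _ _ hst =>
  sup_le_sup_left (biSup_mono fun _ hk => Finset.Icc_subset_Icc_right hst hk) _

theorem measurable_blackCount [Fintype V] (G : SimpleGraph V) [DecidableRel G.Adj]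
    (s t : ℕ) (hst : s ≤ t) (i : V) :
    Measurable[history signal draw t]
      fun ω => blackCount G (fun j => signal j ω) (fun k j => draw k j ω) s i := by
  induction s with
  | zero =>
    exact Measurable.ite (measurable_signal_history t i (measurableSet_singleton true))
      measurable_const measurable_const
  | succ s ih =>
    simp only [blackCount, Finset.card_filter]
    refine (ih (by omega)).add (Finset.measurable_sum _ fun j _ => ?_)
    exact Measurable.ite (measurable_draw_history (Finset.mem_Icc.2 ⟨by omega, hst⟩) j
      (measurableSet_singleton true)) measurable_const measurable_const

theorem measurable_Z [Fintype V] (G : SimpleGraph V) [DecidableRel G.Adj] (t : ℕ) (i : V) :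
    Measurable[history signal draw t] (Z G signal draw t i) := by
  have h : Z G signal draw t i = fun ω =>
      (blackCount G (fun j => signal j ω) (fun k j => draw k j ω) t i : ℝ)
        / (1 + G.degree i * t : ℝ) :=
    funext fun ω => blackProportion_eq_div G _ _ t i
  rw [h]
  exact ((measurable_from_top (f := fun n : ℕ => (n : ℝ))).comp
    (measurable_blackCount G t t le_rfl i)).div_const _

end History

section Probability

variable {V Ω : Type*} [Fintype V] [m0 : MeasurableSpace Ω] {G : SimpleGraph V}
  [DecidableRel G.Adj] {μ : Measure Ω} {signal : V → Ω → Bool} {draw : ℕ → V → Ω → Bool}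

/-- The filtration of signals and draws. -/
def historyFiltration (hproc : IsUrnProcess G μ signal draw) : Filtration ℕ m0 where
  seq := history signal draw
  mono' := history_mono
  le' t := by
    refine sup_le (iSup_le fun i => (hproc.measurable_signal i).comap_le)
      (iSup₂_le fun k hk => iSup_le fun i => ?_)
    obtain ⟨n, rfl⟩ := Nat.exists_eq_add_of_le' (Finset.mem_Icc.1 hk).1
    exact (hproc.measurable_draw n i).comap_le

theorem integrable_of_measurable_of_mem_Icc [IsFiniteMeasure μ] {f : Ω → ℝ} {a b : ℝ}
    (hf : Measurable f) (h : ∀ ω, f ω ∈ Set.Icc a b) : Integrable f μ :=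
  Integrable.of_mem_Icc a b hf.aemeasurable (ae_of_all _ h)

theorem condExp_mul_black_sub_Z [IsProbabilityMeasure μ] (hproc : IsUrnProcess G μ signal draw)
    (t : ℕ) (j : V) {g : Ω → ℝ} {a b : ℝ} (hg : Measurable[history signal draw t] g)
    (hgb : ∀ ω, g ω ∈ Set.Icc a b) :
    Integrable (fun ω => g ω * (black (draw (t + 1) j ω) - Z G signal draw t j ω)) μ ∧
    μ[fun ω => g ω * (black (draw (t + 1) j ω) - Z G signal draw t j ω) |
      history signal draw t] =ᵐ[μ] 0 := by
  have hle : history signal draw t ≤ m0 := (historyFiltration hproc).le t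
  have hind : (fun ω => black (draw (t + 1) j ω)) =
      {ω | draw (t + 1) j ω = true}.indicator fun _ => (1 : ℝ) := by
    ext ω; simp [black, Set.indicator_apply]
  have hB : Measurable fun ω => black (draw (t + 1) j ω) :=
    (measurable_from_top (f := black)).comp (hproc.measurable_draw t j)
  have hBi : Integrable (fun ω => black (draw (t + 1) j ω)) μ :=
    integrable_of_measurable_of_mem_Icc hB fun ω => black_mem_Icc _
  have hZi : Integrable (Z G signal draw t j) μ :=
    integrable_of_measurable_of_mem_Icc ((measurable_Z G t j).mono hle le_rfl)
      fun ω => blackProportion_mem_Icc _ _ _ _ _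
  have hdi : Integrable ((fun ω => black (draw (t + 1) j ω)) - Z G signal draw t j) μ :=
    hBi.sub hZi
  have hgdi : Integrable (g * ((fun ω => black (draw (t + 1) j ω)) - Z G signal draw t j)) μ := by
    refine hdi.bdd_mul (c := max |a| |b|) (hg.mono hle le_rfl).aestronglyMeasurable
      (ae_of_all _ fun ω => ?_)
    exact abs_le_max_abs_abs (hgb ω).1 (hgb ω).2
  refine ⟨hgdi, ?_⟩
  have h1 := condExp_mul_of_stronglyMeasurable_left (m := history signal draw t)
    hg.stronglyMeasurable hgdi hdi
  have h2 := condExp_sub hBi hZi (history signal draw t)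
  rw [condExp_of_stronglyMeasurable hle (measurable_Z G t j).stronglyMeasurable hZi, hind] at h2
  refine h1.trans ?_
  rw [← hind] at h2
  filter_upwards [h2, hproc.condProb_draw t j] with ω h3 h4
  rw [← hind] at h4
  simp [h3, h4]

/-- Any predictable linear combination of the centred draws is a martingale difference. -/
theorem condExp_sum_mul_black_sub_Z [IsProbabilityMeasure μ]
    (hproc : IsUrnProcess G μ signal draw) (t : ℕ) {g : V → Ω → ℝ} {a b : ℝ}
    (hg : ∀ i, Measurable[history signal draw t] (g i)) (hgb : ∀ i ω, g i ω ∈ Set.Icc a b) :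
    Integrable (fun ω => (∑ i, g i ω * ∑ j ∈ G.neighborFinset i,
      (black (draw (t + 1) j ω) - Z G signal draw t j ω)) / (t + 1)) μ ∧
    μ[fun ω => (∑ i, g i ω * ∑ j ∈ G.neighborFinset i,
      (black (draw (t + 1) j ω) - Z G signal draw t j ω)) / (t + 1) |
      history signal draw t] =ᵐ[μ] 0 := by
  have key := fun i j => condExp_mul_black_sub_Z hproc t j (hg i) (hgb i)
  have heq : (fun ω => (∑ i, g i ω * ∑ j ∈ G.neighborFinset i,
      (black (draw (t + 1) j ω) - Z G signal draw t j ω)) / (t + 1)) =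
      ((t : ℝ) + 1)⁻¹ • ∑ i, ∑ j ∈ G.neighborFinset i,
        fun ω => g i ω * (black (draw (t + 1) j ω) - Z G signal draw t j ω) := by
    ext ω
    simp only [Pi.smul_apply, Finset.sum_apply, smul_eq_mul, Finset.mul_sum, Finset.sum_div]
    refine Finset.sum_congr rfl fun i _ => Finset.sum_congr rfl fun j _ => by ring
  have hin : ∀ i, Integrable (∑ j ∈ G.neighborFinset i,
      fun ω => g i ω * (black (draw (t + 1) j ω) - Z G signal draw t j ω)) μ :=
    fun i => integrable_finsetSum' _ fun j _ => (key i j).1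
  rw [heq]
  refine ⟨(integrable_finsetSum' _ fun i _ => hin i).smul _, ?_⟩
  refine (condExp_smul _ _ _).trans ?_
  have h1 := condExp_finsetSum (s := Finset.univ) (fun i _ => hin i) (history signal draw t)
  have h2 : ∀ᵐ ω ∂μ, ∀ i, (μ[∑ j ∈ G.neighborFinset i,
      fun ω => g i ω * (black (draw (t + 1) j ω) - Z G signal draw t j ω) |
      history signal draw t]) ω = 0 := by
    refine ae_all_iff.2 fun i => ?_
    have h3 := condExp_finsetSum (s := G.neighborFinset i) (fun j _ => (key i j).1)
      (history signal draw t)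
    have h4 := ae_all_iff.2 fun j => (key i j).2
    filter_upwards [h3, h4] with ω h3 h4
    rw [h3, Finset.sum_apply]
    exact Finset.sum_eq_zero fun j _ => h4 j
  filter_upwards [h1, h2] with ω h1 h2
  rw [Pi.smul_apply, h1, Finset.sum_apply, Finset.sum_eq_zero fun i _ => h2 i]
  simp

/-- A nonnegative functional of the urns that is bounded at each time is an almost supermartingale as soon
as it increases by at most predictable multiples of the centred draws and an error of order
`1 / (t + 1) ^ 2`; it then converges. -/
theorem ae_exists_tendsto_of_le_add_centred_draws [IsProbabilityMeasure μ]
    (hproc : IsUrnProcess G μ signal draw) {U : ℕ → Ω → ℝ} {g : ℕ → V → Ω → ℝ} {a b C : ℝ}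
    {R : ℕ → ℝ} (hC : 0 ≤ C) (hU : ∀ t, Measurable[history signal draw t] (U t))
    (hUb : ∀ t ω, U t ω ∈ Set.Icc 0 (R t))
    (hg : ∀ t i, Measurable[history signal draw t] (g t i))
    (hgb : ∀ t i ω, g t i ω ∈ Set.Icc a b)
    (hle : ∀ t ω, U (t + 1) ω ≤ U t ω + (∑ i, g t i ω * ∑ j ∈ G.neighborFinset i,
      (black (draw (t + 1) j ω) - Z G signal draw t j ω)) / (t + 1) + C / ((t : ℝ) + 1) ^ 2) :
    ∀ᵐ ω ∂μ, ∃ l : ℝ, Tendsto (fun t => U t ω) atTop (𝓝 l) := by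
  refine ae_exists_tendsto_of_le_add_martingaleDiff (historyFiltration hproc)
    (c := fun t => C / ((t : ℝ) + 1) ^ 2)
    (fun t => (hU t).stronglyMeasurable)
    (fun t => integrable_of_measurable_of_mem_Icc
      ((hU t).mono ((historyFiltration hproc).le t) le_rfl) (hUb t))
    (fun t ω => (hUb t ω).1)
    (fun t => (condExp_sum_mul_black_sub_Z hproc t (hg t) (hgb t)).1)
    (fun t => (condExp_sum_mul_black_sub_Z hproc t (hg t) (hgb t)).2)
    (fun t => by positivity) ?_ hle
  have h := (summable_nat_add_iff 1).2 (Real.summable_one_div_nat_pow.2 one_lt_two)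
  simpa [div_eq_mul_inv] using h.mul_left C

theorem sum_degree_mul_mem_Icc {z : V → ℝ} (hz : ∀ i, z i ∈ Set.Icc (0 : ℝ) 1) :
    ∑ i, G.degree i * z i ∈ Set.Icc (0 : ℝ) (∑ i, (G.degree i : ℝ)) :=
  ⟨Finset.sum_nonneg fun i _ => mul_nonneg (by positivity) (hz i).1,
    Finset.sum_le_sum fun i _ => mul_le_of_le_one_right (by positivity) (hz i).2⟩

theorem energy_le_of_mem_Icc {z : V → ℝ} (hz : ∀ i, z i ∈ Set.Icc (0 : ℝ) 1) :
    energy G z ≤ ∑ i, (G.degree i : ℝ) := by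
  refine Finset.sum_le_sum fun i _ => ?_
  rw [← SimpleGraph.card_neighborFinset_eq_degree, ← mul_one (Finset.card _ : ℝ), ← nsmul_eq_mul]
  refine Finset.sum_le_card_nsmul _ _ _ fun j _ => ?_
  obtain ⟨h1, h2⟩ := hz i
  obtain ⟨h3, h4⟩ := hz j
  exact (sq_le_one_iff_abs_le_one _).2 (abs_le.2 ⟨by linarith, by linarith⟩)

variable [IsProbabilityMeasure μ]

theorem ae_exists_tendsto_sum_degree_mul_Z (hproc : IsUrnProcess G μ signal draw) :
    ∀ᵐ ω ∂μ, ∃ l : ℝ,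
      Tendsto (fun t => ∑ i, G.degree i * Z G signal draw t i ω) atTop (𝓝 l) :=
  ae_exists_tendsto_of_le_add_centred_draws hproc (g := fun _ _ _ => 1) (a := 1) (b := 1)
    (R := fun _ => ∑ i, (G.degree i : ℝ)) (C := ∑ _i : V, 1) (by positivity)
    (fun t => Finset.measurable_sum _ fun i _ => (measurable_Z G t i).const_mul _)
    (fun t ω => sum_degree_mul_mem_Icc fun i => blackProportion_mem_Icc _ _ _ _ _)
    (fun _ _ => measurable_const) (by simp)
    (fun t ω => sum_degree_mul_blackProportion_succ_le G _ _ t)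

/-- The weighted squares converge, both alone (`κ = 0`) and after adding the energy dissipated so
far (`κ = 1`). -/
theorem ae_exists_tendsto_sum_degree_mul_Z_sq_add (hproc : IsUrnProcess G μ signal draw) {κ : ℝ}
    (hκ : κ ∈ Set.Icc (0 : ℝ) 1) :
    ∀ᵐ ω ∂μ, ∃ l : ℝ, Tendsto (fun t => ∑ i, G.degree i * Z G signal draw t i ω ^ 2
      + κ * ∑ s ∈ Finset.range t, energy G (fun i => Z G signal draw s i ω) / (s + 1))
      atTop (𝓝 l) := by
  have hZ : ∀ t i ω, Z G signal draw t i ω ∈ Set.Icc (0 : ℝ) 1 :=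
    fun t i ω => blackProportion_mem_Icc _ _ _ _ _
  have hZ2 : ∀ t i ω, Z G signal draw t i ω ^ 2 ∈ Set.Icc (0 : ℝ) 1 :=
    fun t i ω => ⟨sq_nonneg _, pow_le_one₀ (hZ t i ω).1 (hZ t i ω).2⟩
  have hE0 : ∀ s ω, 0 ≤ energy G (fun i => Z G signal draw s i ω) / ((s : ℝ) + 1) :=
    fun s ω => div_nonneg (energy_nonneg _ _) (by positivity)
  refine ae_exists_tendsto_of_le_add_centred_draws hproc
    (g := fun t i ω => 2 * Z G signal draw t i ω) (a := 0) (b := 2)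
    (R := fun t => ∑ i, (G.degree i : ℝ)
      + ∑ s ∈ Finset.range t, (∑ i, (G.degree i : ℝ)) / ((s : ℝ) + 1))
    (C := ∑ i, (2 + G.degree i : ℝ)) (by positivity) (fun t => ?_) (fun t ω => ⟨?_, ?_⟩)
    (fun t i => (measurable_Z G t i).const_mul _)
    (fun t i ω => ⟨by linarith [(hZ t i ω).1], by linarith [(hZ t i ω).2]⟩) (fun t ω => ?_)
  · refine (Finset.measurable_sum _ fun i _ => ((measurable_Z G t i).pow_const 2).const_mul _).add
      ((Finset.measurable_sum _ fun s hs => Measurable.div_const ?_ _).const_mul _)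
    have hm : ∀ i, Measurable[history signal draw t] (Z G signal draw s i) := fun i =>
      (measurable_Z G s i).mono (history_mono (Finset.mem_range.1 hs).le) le_rfl
    exact Finset.measurable_sum _ fun i _ => Finset.measurable_sum _ fun j _ =>
      ((hm i).sub (hm j)).pow_const 2
  · exact add_nonneg (sum_degree_mul_mem_Icc fun i => hZ2 t i ω).1
      (mul_nonneg hκ.1 (Finset.sum_nonneg fun s _ => hE0 s ω))
  · refine add_le_add (sum_degree_mul_mem_Icc fun i => hZ2 t i ω).2
      ((mul_le_of_le_one_left (Finset.sum_nonneg fun s _ => hE0 s ω) hκ.2).trans ?_)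
    refine Finset.sum_le_sum fun s _ => ?_
    gcongr
    exact energy_le_of_mem_Icc fun i => hZ s i ω
  · have h := sum_degree_mul_blackProportion_sq_succ_le G (fun j => signal j ω)
      (fun k j => draw k j ω) t
    have h2 := mul_le_of_le_one_left (hE0 t ω) hκ.2
    rw [Finset.sum_range_succ, mul_add]
    change ∑ i, G.degree i * Z G signal draw (t + 1) i ω ^ 2
        + energy G (fun i => Z G signal draw t i ω) / ((t : ℝ) + 1) ≤
      ∑ i, G.degree i * Z G signal draw t i ω ^ 2
      + (∑ i, 2 * Z G signal draw t i ω * ∑ j ∈ G.neighborFinset i,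
          (black (draw (t + 1) j ω) - Z G signal draw t j ω)) / ((t : ℝ) + 1)
      + (∑ i, (2 + G.degree i : ℝ)) / ((t : ℝ) + 1) ^ 2 at h
    linarith

end Probability

end UrnNetwork

theorem theorem3 {V : Type*} [Fintype V] (G : SimpleGraph V) [DecidableRel G.Adj]
    (hG : G.Connected)
    {Ω : Type*} [MeasurableSpace Ω] (μ : Measure Ω) [IsProbabilityMeasure μ]
    (signal : V → Ω → Bool) (draw : ℕ → V → Ω → Bool)
    (hproc : UrnNetwork.IsUrnProcess G μ signal draw) :
    ∀ᵐ ω ∂μ, ∃ z : ℝ, ∀ i : V,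
      Tendsto (fun t : ℕ => UrnNetwork.Z G signal draw t i ω) atTop (𝓝 z) := by
  rcases subsingleton_or_nontrivial V with hV | hV
  · -- an isolated agent never receives a ball
    refine ae_of_all _ fun ω => ?_
    obtain ⟨i₀⟩ := hG.nonempty
    refine ⟨UrnNetwork.Z G signal draw 0 i₀ ω, fun i => ?_⟩
    obtain rfl := Subsingleton.elim i i₀
    refine tendsto_const_nhds.congr fun t => ?_
    induction t with
    | zero => rfl
    | succ t ih =>
      have hN : G.neighborFinset i = ∅ := by
        ext j
        simp [Subsingleton.elim j i]
      have h := UrnNetwork.blackProportion_succ G (fun j => signal j ω) (fun k j => draw k j ω) t i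
      rw [hN, Finset.sum_empty, zero_div, add_zero] at h
      exact ih.trans h.symm
  · filter_upwards [UrnNetwork.ae_exists_tendsto_sum_degree_mul_Z hproc,
      UrnNetwork.ae_exists_tendsto_sum_degree_mul_Z_sq_add hproc (κ := 0) (by simp),
      UrnNetwork.ae_exists_tendsto_sum_degree_mul_Z_sq_add hproc (κ := 1) (by simp)]
      with ω ⟨m, hm⟩ ⟨e, he⟩ ⟨e', he'⟩
    simp only [zero_mul, add_zero] at he
    have hA := he'.sub he
    simp only [one_mul, add_sub_cancel_left] at hA
    refine UrnNetwork.exists_tendsto_of_summable_energy G hG hm he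
      (z := fun t i => UrnNetwork.Z G signal draw t i ω) ?_
    exact ((hasSum_iff_tendsto_nat_of_nonneg
      (fun s => div_nonneg (UrnNetwork.energy_nonneg _ _) (by positivity)) _).2 hA).summable
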